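/- For $h\in L^1(\mathbb{R})$ write $\widehat h(\omega)=\int_{\mathbb{R}} h(x)e^{-ix\omega}\,dx$, and let $(Ph)(\omega)=|\widehat h(\omega)|^2$, $\omega\in\mathbb{R}$, be the power spectrum of $h$. Let $\psi:\mathbb{R}\to\mathbb{C}$ be a wavelet, that is, $\psi\in L^1\cap L^2(\mathbb{R})$ with $\int\psi=0$, $\|\psi\|_2=1$ and $\int_{\mathbb{R}}|\widehat\psi(\omega)|^2/|\omega|\,d\omega<\infty$. For $\lambda>0$ put $\psi_\lambda(x)=\lambda^{1/2}\psi(\lambda x)$ and $$|\widehat\psi_\lambda^+(\omega)|^2=\bigl(|\widehat\psi_\lambda(\omega)|^2+|\widehat\psi_\lambda(-\omega)|^2\bigr)\,\mathbf 1(\omega\ge 0).$$ Assume that $\widehat\psi$ has compact support and that, for any finitely many distinct positive frequencies $\omega_1,\dots,\omega_n$, the functions $\lambda\mapsto|\widehat\psi_\lambda^+(\omega_i)|^2$, $1\le i\le n$, on $(0,\infty)$ are linearly independent. For a real-valued $h\in L^1\cap L^2(\mathbb{R})$ define its wavelet invariants by $(Sh)(\lambda)=\|h*\psi_\lambda\|_2^2$,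 $\lambda\in(0,\infty)$. Theorem. For all real-valued $f,g\in L^1\cap L^2(\mathbb{R})$, $$Sf=Sg\ \text{ on } (0,\infty)\quad\Longleftrightarrow\quad Pf=Pg\ \text{ on } \mathbb{R}.$$ -/

import Mathlib

open MeasureTheory
open scoped ENNReal Convolution

noncomputable section

namespace WaveletInvariants

/-- The Fourier transform in angular frequency, `f̂(ω) = ∫ f(x) e^{-i x ω} dx`. -/
def angularFourier (f : ℝ → ℂ) (ω : ℝ) : ℂ :=
  ∫ x : ℝ, f x * Complex.exp (-(Complex.I * (x : ℂ) * (ω : ℂ)))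

/-- The power spectrum `(Pf)(ω) = |f̂(ω)|²` of a real-valued signal. -/
def powerSpectrum (f : ℝ → ℝ) (ω : ℝ) : ℝ :=
  ‖angularFourier (fun x => (f x : ℂ)) ω‖ ^ 2

/-- The dilation `ψ_l(x) = l^{1/2} ψ(l x)` of `ψ`, used for `l > 0`. -/
def dilate (ψ : ℝ → ℂ) (l : ℝ) (x : ℝ) : ℂ :=
  ((Real.sqrt l : ℝ) : ℂ) * ψ (l * x)

/-- A (real or complex) wavelet in `L¹ ∩ L²(ℝ)`: zero average, unit `L²` norm, and the classical
admissibility condition `∫ |ψ̂(ω)|² / |ω| dω < ∞`. -/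
structure IsWavelet (ψ : ℝ → ℂ) : Prop where
  memLp_one : MemLp ψ 1 volume
  memLp_two : MemLp ψ 2 volume
  integral_eq_zero : ∫ x : ℝ, ψ x = 0
  norm_eq_one : eLpNorm ψ 2 volume = 1
  admissible : Integrable (fun ω : ℝ => ‖angularFourier ψ ω‖ ^ 2 / |ω|) volume

/-- The `L²` wavelet invariants `(Sf)(l) = ‖f ∗ ψ_l‖₂²`, `l ∈ (0, ∞)`. -/
def waveletInvariant (ψ : ℝ → ℂ) (f : ℝ → ℝ) (l : Set.Ioi (0 : ℝ)) : ℝ≥0∞ :=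
  (eLpNorm (f ⋆[ContinuousLinearMap.lsmul ℝ ℝ, volume] dilate ψ l) 2 volume) ^ 2

/-- `|ψ̂⁺_l(ω)|² = (|ψ̂_l(ω)|² + |ψ̂_l(-ω)|²) · 1(ω ≥ 0)`. -/
def foldedSpectrum (ψ : ℝ → ℂ) (l : ℝ) (ω : ℝ) : ℝ :=
  Set.indicator (Set.Ici (0 : ℝ))
    (fun ν => ‖angularFourier (dilate ψ l) ν‖ ^ 2 + ‖angularFourier (dilate ψ l) (-ν)‖ ^ 2) ω

/-- The linear independence condition: for any finitely many distinct positive frequencies `ω i`,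
the functions `l ↦ |ψ̂⁺_l(ω i)|²` on `(0, ∞)` are linearly independent. -/
def LinearIndependenceCondition (ψ : ℝ → ℂ) : Prop :=
  ∀ (n : ℕ) (ω : Fin n → ℝ), Function.Injective ω → (∀ i, 0 < ω i) →
    LinearIndependent ℝ
      (fun (i : Fin n) (l : Set.Ioi (0 : ℝ)) => foldedSpectrum ψ (l : ℝ) (ω i))

end WaveletInvariants

end

/-!
Write `P f = |f̂|²` and `K(v) = |ψ̂(v)|² + |ψ̂(-v)|²`. Plancherel turns the wavelet invariants into
integrals of the power spectrum,
`(S f)(l) = ∫ |f̂(ξ)|² · |ψ̂_l(ξ)|² dξ` (`waveletInvariant_eq_lintegral`), so `P f = P g` implies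
`S f = S g`. Plancherel is needed for a convolution of which only integrability is known
beforehand, hence it is proved for all of `L¹`, both sides being possibly infinite
(`eLpNorm_fourier_eq`).

Conversely, let `S f = S g`. The function `p = P f - P g` is continuous, integrable and, as `f` and
`g` are real-valued, even, so that `∫_0^∞ p(x) K(x / l) dx = 0` for all `l > 0`. This is a
multiplicative convolution equation. In logarithmic scale, with
`A(t) = e^{t/2} p(e^t)` and `B(u) = e^{-u/2} K(e^{-u})`, both continuous and integrable on the line,
it reads `A ⋆ B = 0`, that is, `Â · B̂ = 0`. Now `B̂(ξ)` is the Mellin transform of `K` at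
`1/2 + 2πiξ`. Since `K` is continuous with compact support, its Mellin transform is holomorphic on
the right half-plane, so `B̂` is real-analytic. If `Â` were nonzero somewhere, then, being
continuous, it would be nonzero on an open set, on which `B̂` would vanish; by analyticity `B̂`
would vanish everywhere, and `K` would vanish on `(0, ∞)`. The linear independence condition for a
single frequency excludes this. Hence `Â = 0`, so `p = 0` on
`(0, ∞)` (`eq_zero_of_forall_integral_comp_div_eq_zero`), and on all of `ℝ` by continuity and
evenness.

Mathlib's normalization `𝓕 f ξ = ∫ f(x) e^{-2πixξ} dx` is used throughout;
`angularFourier f ω = 𝓕 f (ω / 2π)`.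
-/

open FourierTransform SchwartzMap

namespace WaveletInvariants

/-! ### Plancherel's theorem for integrable functions -/

theorem continuous_fourier {u : ℝ → ℂ} (hu : Integrable u) : Continuous (𝓕 u) :=
  VectorFourier.fourierIntegral_continuous Real.continuous_fourierChar (by fun_prop) hu

theorem integral_schwartz_smul_fourier {u : ℝ → ℂ} (hu : Integrable u) (φ : 𝓢(ℝ, ℂ)) :
    ∫ x, φ x • 𝓕 u x = ∫ x, (𝓕 φ) x • u x := by
  have := VectorFourier.integral_fourierIntegral_smul_eq_flip (L := innerₗ ℝ)
    (μ := volume) (ν := volume) Real.continuous_fourierChar (by fun_prop) φ.integrable hu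
  rw [flip_innerₗ] at this
  exact this.symm

theorem ae_eq_of_integral_schwartz_smul_eq {u v : ℝ → ℂ} (hu : LocallyIntegrable u)
    (hv : LocallyIntegrable v) (h : ∀ φ : 𝓢(ℝ, ℂ), ∫ x, φ x • u x = ∫ x, φ x • v x) :
    u =ᵐ[volume] v := by
  refine ae_eq_of_integral_contDiff_smul_eq hu hv fun g hg hgc => ?_
  have hg₁ : HasCompactSupport (Complex.ofRealCLM ∘ g) := hgc.comp_left rfl
  have hg₂ : ContDiff ℝ ((⊤ : ℕ∞) : WithTop ℕ∞) (Complex.ofRealCLM ∘ g) := by fun_prop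
  simpa using h (hg₁.toSchwartzMap hg₂)

/-- On `L¹ ∩ L²` the `L²` Fourier transform is given by the Fourier integral. -/
theorem fourier_toLp_ae_eq {u : ℝ → ℂ} (hu : Integrable u) (hu₂ : MemLp u 2) :
    (𝓕 (hu₂.toLp u) : Lp ℂ 2 (volume : Measure ℝ)) =ᵐ[volume] 𝓕 u := by
  refine ae_eq_of_integral_schwartz_smul_eq ((Lp.memLp _).locallyIntegrable one_le_two)
    (continuous_fourier hu).locallyIntegrable fun φ => ?_
  have h1 : (𝓕 ((hu₂.toLp u : Lp ℂ 2 (volume : Measure ℝ)) : 𝓢'(ℝ, ℂ))) φ =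
      ((𝓕 (hu₂.toLp u) : Lp ℂ 2 (volume : Measure ℝ)) : 𝓢'(ℝ, ℂ)) φ := by
    rw [Lp.fourier_toTemperedDistribution_eq]
  rw [TemperedDistribution.fourier_apply, Lp.toTemperedDistribution_apply,
    Lp.toTemperedDistribution_apply] at h1
  have h2 : ∫ x, (𝓕 φ) x • (hu₂.toLp u) x = ∫ x, (𝓕 φ) x • u x :=
    integral_congr_ae (by filter_upwards [hu₂.coeFn_toLp] with x hx; rw [hx])
  rw [h2, ← integral_schwartz_smul_fourier hu] at h1
  exact h1.symm

/-- An integrable function with square-integrable Fourier transform `𝓕 u` agrees with the `L²`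
inverse Fourier transform of `𝓕 u`, because both define the same tempered distribution. -/
theorem memLp_two_of_fourier {u : ℝ → ℂ} (hu : Integrable u) (hFu : MemLp (𝓕 u) 2) :
    MemLp u 2 := by
  set v : Lp ℂ 2 (volume : Measure ℝ) := 𝓕⁻ (hFu.toLp (𝓕 u)) with hv
  suffices h : v =ᵐ[volume] u from (memLp_congr_ae h).1 (Lp.memLp v)
  refine ae_eq_of_integral_schwartz_smul_eq ((Lp.memLp _).locallyIntegrable one_le_two)
    hu.locallyIntegrable fun φ => ?_
  have h1 : (𝓕⁻ ((hFu.toLp (𝓕 u) : Lp ℂ 2 (volume : Measure ℝ)) : 𝓢'(ℝ, ℂ))) φ =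
      (v : 𝓢'(ℝ, ℂ)) φ := by
    rw [Lp.fourierInv_toTemperedDistribution_eq]
  rw [TemperedDistribution.fourierInv_apply, Lp.toTemperedDistribution_apply,
    Lp.toTemperedDistribution_apply] at h1
  have h2 : ∫ x, (𝓕⁻ φ) x • (hFu.toLp (𝓕 u)) x = ∫ x, (𝓕⁻ φ) x • 𝓕 u x :=
    integral_congr_ae (by filter_upwards [hFu.coeFn_toLp] with x hx; rw [hx])
  rw [h2, integral_schwartz_smul_fourier hu, FourierTransform.fourier_fourierInv_eq] at h1
  exact h1.symm

/-- Plancherel's theorem for integrable functions; both sides may be infinite. -/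
theorem eLpNorm_fourier_eq {u : ℝ → ℂ} (hu : Integrable u) :
    eLpNorm (𝓕 u) 2 volume = eLpNorm u 2 volume := by
  by_cases hu₂ : MemLp u 2
  · rw [← eLpNorm_congr_ae (fourier_toLp_ae_eq hu hu₂), ← eLpNorm_congr_ae hu₂.coeFn_toLp,
      ← Lp.enorm_def, ← Lp.enorm_def, ← ofReal_norm, ← ofReal_norm, Lp.norm_fourier_eq]
  · have h1 : eLpNorm u 2 volume = ∞ := by
      by_contra h
      exact hu₂ ⟨hu.1, lt_top_iff_ne_top.2 h⟩
    have h2 : eLpNorm (𝓕 u) 2 volume = ∞ := by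
      by_contra h
      exact hu₂ (memLp_two_of_fourier hu
        ⟨(continuous_fourier hu).aestronglyMeasurable, lt_top_iff_ne_top.2 h⟩)
    rw [h1, h2]

theorem fourier_injective_of_continuous {f : ℝ → ℂ} (hf : Continuous f) (hfi : Integrable f)
    (h : ∀ ξ, 𝓕 f ξ = 0) : f = 0 := by
  have h0 : 𝓕 f = 0 := funext h
  have := hf.fourierInv_fourier_eq hfi (by rw [h0]; exact integrable_zero _ _ _)
  rw [← this, h0]
  ext x
  simp [Real.fourierInv_eq']

/-! ### Multiplicative convolution in logarithmic scale -/

/-- The function `u ↦ e^{-u/2} f(e^{-u})`. Its Fourier transform is the Mellin transform of `f` on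
the line `Re s = 1/2`. -/
noncomputable def logScale (f : ℝ → ℂ) (u : ℝ) : ℂ := Real.exp (-(1 / 2) * u) • f (Real.exp (-u))

theorem continuous_logScale {f : ℝ → ℂ} (hf : Continuous f) : Continuous (logScale f) := by
  unfold logScale
  fun_prop

theorem integrable_logScale {f : ℝ → ℂ} (hf : Continuous f)
    (hfi : IntegrableOn f (Set.Ioi 0)) : Integrable (logScale f) := by
  -- `t^{-1/2}` is integrable near `0`, where `f` is bounded, and bounded near infinity, where `f`
  -- is integrable.
  have h0 : IntegrableOn (fun t : ℝ => t ^ (-(1 / 2) : ℝ) • f t) (Set.Ioi 0) := by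
    rw [← Set.Ioc_union_Ioi_eq_Ioi (zero_le_one' ℝ)]
    refine IntegrableOn.union ?_ ?_
    · refine IntegrableOn.smul_continuousOn_of_subset (K := Set.Icc 0 1) ?_ hf.continuousOn
        measurableSet_Ioc isCompact_Icc Set.Ioc_subset_Icc_self
      exact (intervalIntegrable_iff_integrableOn_Ioc_of_le zero_le_one).1
        (intervalIntegral.intervalIntegrable_rpow' (by norm_num))
    · have hf1 : Integrable f (volume.restrict (Set.Ioi 1)) :=
        hfi.mono_set (Set.Ioi_subset_Ioi zero_le_one)
      refine hf1.bdd_smul (φ := fun t : ℝ => t ^ (-(1 / 2) : ℝ)) 1 ?_ ?_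
      · exact (measurable_id.pow_const _).aestronglyMeasurable
      · filter_upwards [ae_restrict_mem measurableSet_Ioi] with t ht
        rw [Real.norm_of_nonneg (Real.rpow_nonneg (zero_le_one.trans (le_of_lt ht)) _)]
        exact Real.rpow_le_one_of_one_le_of_nonpos (le_of_lt ht) (by norm_num)
  have himg : (fun u : ℝ => Real.exp (-u)) '' Set.univ = Set.Ioi 0 := by
    rw [Set.image_univ, ← Real.range_exp]
    exact neg_surjective.range_comp Real.exp
  rw [← himg, integrableOn_image_iff_integrableOn_abs_deriv_smul MeasurableSet.univ
    (f' := fun u => -Real.exp (-u)) (fun u _ => by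
      simpa using ((hasDerivAt_neg u).exp).hasDerivWithinAt (s := Set.univ))
    (fun x _ y _ h => by simpa using h), integrableOn_univ] at h0
  refine h0.congr (Filter.Eventually.of_forall fun u => ?_)
  simp only [logScale, smul_smul, abs_neg, Real.abs_exp, ← Real.exp_mul, ← Real.exp_add]
  congr 2
  ring

theorem integral_Ioi_eq_integral_exp (F : ℝ → ℂ) :
    ∫ x in Set.Ioi 0, F x = ∫ t, Real.exp t • F (Real.exp t) := by
  have himg : Real.exp '' Set.univ = Set.Ioi 0 := by rw [Set.image_univ, Real.range_exp]
  rw [← himg, integral_image_eq_integral_abs_deriv_smul MeasurableSet.univ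
    (fun u _ => (Real.hasDerivAt_exp u).hasDerivWithinAt) Real.exp_injective.injOn]
  simp

/-- The integrals `∫_0^∞ p(x) φ(x / l) dx`, with `l = e^s`, are an additive convolution in
logarithmic scale. -/
theorem convolution_logScale (p φ : ℝ → ℂ) (s : ℝ) :
    ((fun t => logScale p (-t)) ⋆[ContinuousLinearMap.mul ℂ ℂ, volume] logScale φ) s =
      Real.exp (-(1 / 2) * s) • ∫ x in Set.Ioi 0, p x * φ (x / Real.exp s) := by
  rw [integral_Ioi_eq_integral_exp, ← integral_smul]
  refine integral_congr_ae (Filter.Eventually.of_forall fun t => ?_)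
  have h : Real.exp t = Real.exp (-(1 / 2) * -t) * Real.exp (1 / 2 * t) := by
    rw [← Real.exp_add]; congr 1; ring
  have h' : Real.exp (-(1 / 2) * (s - t)) = Real.exp (-(1 / 2) * s) * Real.exp (1 / 2 * t) := by
    rw [← Real.exp_add]; congr 1; ring
  simp only [logScale, ContinuousLinearMap.mul_apply', neg_neg, neg_sub, ← Real.exp_sub,
    Complex.real_smul, h']
  conv_rhs => enter [2, 1]; rw [h]
  push_cast
  ring

/-- The Mellin transform of a continuous compactly supported function is holomorphic on
`Re s > 0`, hence real-analytic along the line `Re s = 1/2`. -/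
theorem analyticOnNhd_fourier_logScale {φ : ℝ → ℂ} (hφ : Continuous φ)
    (hφc : HasCompactSupport φ) : AnalyticOnNhd ℝ (𝓕 (logScale φ)) Set.univ := by
  have hM : DifferentiableOn ℂ (mellin φ) {z | 0 < z.re} := fun z hz => by
    refine (mellin_differentiableAt_of_isBigO_rpow (a := z.re + 1) (b := 0)
      (hφ.locallyIntegrable.locallyIntegrableOn _) ?_ (by simp) ?_ hz).differentiableWithinAt
    · refine Filter.EventuallyEq.trans_isBigO (f₂ := fun _ => 0) ?_ (Asymptotics.isBigO_zero _ _)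
      refine (hasCompactSupport_iff_eventuallyEq.1 hφc).filter_mono ?_
      rw [Filter.coclosedCompact_eq_cocompact]
      exact atTop_le_cocompact
    · simp only [neg_zero, Real.rpow_zero]
      exact ((hφ.tendsto 0).mono_left nhdsWithin_le_nhds).isBigO_one ℝ
  have hA := hM.analyticOnNhd (isOpen_lt continuous_const Complex.continuous_re)
  have h : 𝓕 (logScale φ) = fun ξ : ℝ =>
      mellin φ ((1 / 2 : ℂ) + 2 * Real.pi * (ξ : ℂ) * Complex.I) := by
    ext ξ
    have h2 : 2 * Real.pi * ξ / (2 * Real.pi) = ξ := by field_simp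
    have hre : ((1 / 2 : ℂ) + 2 * Real.pi * (ξ : ℂ) * Complex.I).re = 1 / 2 := by simp
    have him : ((1 / 2 : ℂ) + 2 * Real.pi * (ξ : ℂ) * Complex.I).im = 2 * Real.pi * ξ := by simp
    rw [mellin_eq_fourier, hre, him, h2]
    rfl
  rw [h]
  intro ξ _
  have hξ := (hA ((1 / 2 : ℂ) + 2 * Real.pi * (ξ : ℂ) * Complex.I) (by simp)).restrictScalars
    (𝕜 := ℝ)
  refine AnalyticAt.fun_comp hξ ?_
  have : AnalyticAt ℝ (fun x : ℝ => (x : ℂ)) ξ := Complex.ofRealCLM.analyticAt ξ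
  fun_prop

/-- The multiplicative dilates of a continuous compactly supported function that does not vanish
identically on `(0, ∞)` separate the continuous integrable functions on `(0, ∞)`. -/
theorem eq_zero_of_forall_integral_comp_div_eq_zero {p φ : ℝ → ℂ}
    (hp : Continuous p) (hpi : IntegrableOn p (Set.Ioi 0))
    (hφ : Continuous φ) (hφc : HasCompactSupport φ) {v : ℝ} (hv : 0 < v) (hφv : φ v ≠ 0)
    (h : ∀ l : ℝ, 0 < l → ∫ x in Set.Ioi 0, p x * φ (x / l) = 0) {x : ℝ} (hx : 0 < x) :
    p x = 0 := by
  have hA := (integrable_logScale hp hpi).comp_neg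
  have hAc : Continuous (fun t => logScale p (-t)) := (continuous_logScale hp).comp continuous_neg
  have hB := integrable_logScale hφ (hφ.integrable_of_hasCompactSupport hφc).integrableOn
  have hprod (ξ : ℝ) : 𝓕 (fun t => logScale p (-t)) ξ * 𝓕 (logScale φ) ξ = 0 := by
    rw [← Real.fourier_mul_convolution_eq hA hB]
    have : ((fun t => logScale p (-t)) ⋆[ContinuousLinearMap.mul ℂ ℂ, volume] logScale φ) = 0 := by
      ext s
      rw [convolution_logScale, h _ (Real.exp_pos s), smul_zero, Pi.zero_apply]
    rw [this]
    simp [Real.fourier_eq']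
  have hAz : ∀ ξ, 𝓕 (fun t => logScale p (-t)) ξ = 0 := by
    by_contra! hne
    obtain ⟨ξ₀, hξ₀⟩ := hne
    have hev : 𝓕 (logScale φ) =ᶠ[nhds ξ₀] 0 := by
      filter_upwards [(continuous_fourier hA).continuousAt.eventually_ne hξ₀] with ξ hξ
      exact (mul_eq_zero.1 (hprod ξ)).resolve_left hξ
    have hz := (analyticOnNhd_fourier_logScale hφ hφc).eq_of_eventuallyEq
      (fun _ _ => analyticAt_const) hev
    have hφ0 := congrFun (fourier_injective_of_continuous (continuous_logScale hφ) hB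
      (congrFun hz)) (-Real.log v)
    exact hφv (by simpa [logScale, Real.exp_log hv] using hφ0)
  have := congrFun (fourier_injective_of_continuous hAc hA hAz) (Real.log x)
  simpa [logScale, Real.exp_log hx] using this

/-! ### Wavelet invariants as integrals of the power spectrum -/

theorem angularFourier_eq_fourier (f : ℝ → ℂ) (ω : ℝ) :
    angularFourier f ω = 𝓕 f (ω / (2 * Real.pi)) := by
  rw [Real.fourier_eq', angularFourier]
  congr 1
  ext x
  have h : (-2 * Real.pi * inner ℝ x (ω / (2 * Real.pi)) : ℝ) = -(x * ω) := by
    simp only [RCLike.inner_apply, conj_trivial]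
    field_simp
  rw [h, smul_eq_mul, mul_comm]
  congr 2
  push_cast
  ring

theorem fourier_eq_angularFourier (f : ℝ → ℂ) (ξ : ℝ) :
    𝓕 f ξ = angularFourier f (2 * Real.pi * ξ) := by
  rw [angularFourier_eq_fourier]
  field_simp

theorem powerSpectrum_eq_iff (f g : ℝ → ℝ) :
    powerSpectrum f = powerSpectrum g ↔
      ∀ ξ, ‖𝓕 (fun x => (f x : ℂ)) ξ‖ ^ 2 = ‖𝓕 (fun x => (g x : ℂ)) ξ‖ ^ 2 := by
  refine ⟨fun h ξ => ?_, fun h => funext fun ω => ?_⟩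
  · simpa only [fourier_eq_angularFourier] using! congrFun h (2 * Real.pi * ξ)
  · simpa only [powerSpectrum, angularFourier_eq_fourier] using h (ω / (2 * Real.pi))

/-- The power spectrum of a real-valued function is even. -/
theorem norm_fourier_ofReal_neg (f : ℝ → ℝ) (ξ : ℝ) :
    ‖𝓕 (fun x => (f x : ℂ)) (-ξ)‖ = ‖𝓕 (fun x => (f x : ℂ)) ξ‖ := by
  rw [← Complex.norm_conj (𝓕 (fun x => (f x : ℂ)) ξ), Real.fourier_eq', Real.fourier_eq',
    ← integral_conj]
  congr 2
  ext x
  simp [← Complex.exp_conj, Complex.conj_ofNat]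

theorem integrable_dilate {ψ : ℝ → ℂ} (hψ : Integrable ψ) {l : ℝ} (hl : 0 < l) :
    Integrable (dilate ψ l) :=
  (hψ.comp_mul_left' hl.ne').const_mul _

theorem norm_fourier_dilate_sq (ψ : ℝ → ℂ) {l : ℝ} (hl : 0 < l) (ξ : ℝ) :
    ‖𝓕 (dilate ψ l) ξ‖ ^ 2 = l⁻¹ * ‖𝓕 ψ (ξ / l)‖ ^ 2 := by
  have h : 𝓕 (dilate ψ l) ξ = ((Real.sqrt l * l⁻¹ : ℝ) : ℂ) * 𝓕 ψ (ξ / l) := by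
    rw [Real.fourier_eq', Real.fourier_eq']
    have := Measure.integral_comp_mul_left
      (fun y : ℝ => Complex.exp ((-2 * Real.pi * inner ℝ y (ξ / l) : ℝ) * Complex.I) • ψ y) l
    rw [abs_of_pos (inv_pos.2 hl)] at this
    rw [Complex.ofReal_mul, mul_assoc, ← Complex.real_smul (x := l⁻¹), ← this,
      ← integral_const_mul]
    congr 1
    ext x
    have hx : (inner ℝ (l * x) (ξ / l) : ℝ) = inner ℝ x ξ := by
      simp only [RCLike.inner_apply, conj_trivial]
      field_simp
    rw [hx, dilate, smul_eq_mul, smul_eq_mul]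
    ring
  rw [h, norm_mul, mul_pow, Complex.norm_real, Real.norm_eq_abs, sq_abs, mul_pow,
    Real.sq_sqrt hl.le]
  field_simp

theorem waveletInvariant_eq_lintegral {ψ : ℝ → ℂ} (hψ : Integrable ψ) {f : ℝ → ℝ}
    (hf : Integrable f) (l : Set.Ioi (0 : ℝ)) :
    waveletInvariant ψ f l = ∫⁻ ξ, ENNReal.ofReal
      (‖𝓕 (fun x => (f x : ℂ)) ξ‖ ^ 2 * ‖𝓕 (dilate ψ l) ξ‖ ^ 2) := by
  have hd := integrable_dilate hψ l.2
  have hfC : Integrable (fun x => (f x : ℂ)) := hf.ofReal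
  have hconv : (f ⋆[ContinuousLinearMap.lsmul ℝ ℝ, volume] dilate ψ l) =
      ((fun x => (f x : ℂ)) ⋆[ContinuousLinearMap.mul ℂ ℂ, volume] dilate ψ l) := by
    ext x
    simp [MeasureTheory.convolution]
  rw [waveletInvariant, hconv,
    ← eLpNorm_fourier_eq (hfC.integrable_convolution (ContinuousLinearMap.mul ℂ ℂ) hd),
    eLpNorm_eq_lintegral_rpow_enorm_toReal two_ne_zero ENNReal.ofNat_ne_top, ← ENNReal.rpow_natCast,
    ← ENNReal.rpow_mul]
  simp only [ENNReal.toReal_ofNat, Nat.cast_ofNat, one_div, inv_mul_cancel₀ (two_ne_zero' ℝ),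
    ENNReal.rpow_one]
  refine lintegral_congr fun ξ => ?_
  rw [Real.fourier_mul_convolution_eq hfC hd, ← mul_pow, ← norm_mul,
    ENNReal.ofReal_pow (norm_nonneg _), ofReal_norm, ← ENNReal.rpow_natCast]
  norm_num

theorem integrable_norm_fourier_sq {u : ℝ → ℂ} (hu : Integrable u) (hu₂ : MemLp u 2) :
    Integrable (fun ξ => ‖𝓕 u ξ‖ ^ 2) :=
  (memLp_two_iff_integrable_sq_norm (continuous_fourier hu).aestronglyMeasurable).1
    ⟨(continuous_fourier hu).aestronglyMeasurable, by
      rw [eLpNorm_fourier_eq hu]; exact hu₂.eLpNorm_lt_top⟩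

theorem integral_even_mul {p q : ℝ → ℝ} (hp : ∀ x, p (-x) = p x)
    (hpq : Integrable (fun x => p x * q x)) :
    ∫ x in Set.Ioi 0, p x * (q x + q (-x)) = ∫ x, p x * q x := by
  have hneg : Integrable (fun x => p x * q (-x)) := by simpa only [hp] using hpq.comp_neg
  have h := integral_comp_neg_Ioi 0 (fun x => p x * q x)
  simp only [hp, neg_zero] at h
  simp only [mul_add]
  rw [integral_add hpq.integrableOn hneg.integrableOn, h, add_comm,
    intervalIntegral.integral_Iic_add_Ioi hpq.integrableOn hpq.integrableOn]

/-- The wavelet invariants determine the power spectrum. -/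
theorem norm_fourier_sq_eq_of_waveletInvariant_eq {ψ : ℝ → ℂ} (hψ : Integrable ψ)
    (hcond : LinearIndependenceCondition ψ) (hsupp : HasCompactSupport (𝓕 ψ)) {f g : ℝ → ℝ}
    (hf : Integrable f) (hf₂ : MemLp f 2) (hg : Integrable g) (hg₂ : MemLp g 2)
    (h : waveletInvariant ψ f = waveletInvariant ψ g) (ξ : ℝ) :
    ‖𝓕 (fun x => (f x : ℂ)) ξ‖ ^ 2 = ‖𝓕 (fun x => (g x : ℂ)) ξ‖ ^ 2 := by
  set q : ℝ → ℝ := fun v => ‖𝓕 ψ v‖ ^ 2 with hq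
  set p : ℝ → ℝ := fun ξ => ‖𝓕 (fun x => (f x : ℂ)) ξ‖ ^ 2 - ‖𝓕 (fun x => (g x : ℂ)) ξ‖ ^ 2 with hp
  have hqc : Continuous q := (continuous_fourier hψ).norm.pow 2
  have hqs : HasCompactSupport q := hsupp.comp_left (g := fun z : ℂ => ‖z‖ ^ 2) (by simp)
  have hofReal {r : ℝ → ℝ} (hr : Integrable r) : Integrable (fun x => (r x : ℂ)) := hr.ofReal
  have hpc : Continuous p := ((continuous_fourier (hofReal hf)).norm.pow 2).sub
    ((continuous_fourier (hofReal hg)).norm.pow 2)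
  have hFf := integrable_norm_fourier_sq (hofReal hf) hf₂.ofReal
  have hFg := integrable_norm_fourier_sq (hofReal hg) hg₂.ofReal
  have hpi : Integrable p := hFf.sub hFg
  have hpe (x : ℝ) : p (-x) = p x := by simp only [hp, norm_fourier_ofReal_neg]
  obtain ⟨C, hC⟩ := hqs.exists_bound_of_continuous hqc
  -- Multiplication by a dilate of `q` preserves integrability, as `q` is bounded.
  have hmul {r : ℝ → ℝ} (hr : Integrable r) (l : ℝ) : Integrable (fun x => r x * q (x / l)) :=
    hr.mul_bdd (c := C) (hqc.comp (continuous_id.div_const l)).aestronglyMeasurable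
      (Filter.Eventually.of_forall fun x => hC _)
  have hint {f : ℝ → ℝ} (hf : Integrable f) (l : Set.Ioi (0 : ℝ)) :
      ∫ x, ‖𝓕 (fun x => (f x : ℂ)) x‖ ^ 2 * q (x / l) =
        l * (waveletInvariant ψ f l).toReal := by
    rw [waveletInvariant_eq_lintegral hψ hf, ← integral_eq_lintegral_of_nonneg_ae
      (Filter.Eventually.of_forall fun x => mul_nonneg (sq_nonneg _) (sq_nonneg _))
      (Continuous.aestronglyMeasurable (((continuous_fourier (hofReal hf)).norm.pow 2).mul
        ((continuous_fourier (integrable_dilate hψ l.2)).norm.pow 2))),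
      ← integral_const_mul]
    congr 1
    ext x
    have hl : (l : ℝ) ≠ 0 := (Set.mem_Ioi.1 l.2).ne'
    rw [norm_fourier_dilate_sq ψ l.2]
    field_simp
    rfl
  have hzero (l : ℝ) (hl : 0 < l) :
      ∫ x in Set.Ioi 0, p x * (q (x / l) + q (-(x / l))) = 0 := by
    have h1 := integral_even_mul (q := fun x => q (x / l)) hpe (hmul hpi l)
    simp only [neg_div] at h1
    rw [h1]
    simp only [hp, sub_mul]
    rw [integral_sub (hmul hFf l) (hmul hFg l), hint hf ⟨l, hl⟩, hint hg ⟨l, hl⟩, h, sub_self]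
  -- A single frequency in the linear independence condition shows that the folded spectrum does
  -- not vanish.
  obtain ⟨v, hv, hqv⟩ : ∃ v : ℝ, 0 < v ∧ q v + q (-v) ≠ 0 := by
    have hne := (hcond 1 (fun _ => 1) (Function.injective_of_subsingleton _)
      (fun _ => one_pos)).ne_zero 0
    obtain ⟨l, hl⟩ := Function.ne_iff.1 hne
    have hl0 : (0 : ℝ) < l := l.2
    refine ⟨1 / (2 * Real.pi) / l, by positivity, fun h0 => hl ?_⟩
    simp only [foldedSpectrum, Set.indicator_of_mem (Set.mem_Ici.2 zero_le_one),
      angularFourier_eq_fourier, norm_fourier_dilate_sq ψ hl0, neg_div, ← mul_add]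
    simp only [hq] at h0
    rw [h0, mul_zero, Pi.zero_apply]
  have hpos {x : ℝ} (hx : 0 < x) : p x = 0 := by
    have := eq_zero_of_forall_integral_comp_div_eq_zero (p := fun x => (p x : ℂ))
      (φ := fun x => ((q x + q (-x) : ℝ) : ℂ)) (Complex.continuous_ofReal.comp hpc)
      (hofReal hpi).integrableOn
      (Complex.continuous_ofReal.comp (hqc.add (hqc.comp continuous_neg)))
      ((hqs.add (hqs.comp_homeomorph (Homeomorph.neg ℝ))).comp_left Complex.ofReal_zero)
      hv (Complex.ofReal_ne_zero.2 hqv) (fun l hl => by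
        simp only [← Complex.ofReal_mul]
        rw [integral_complex_ofReal, hzero l hl, Complex.ofReal_zero]) hx
    exact Complex.ofReal_eq_zero.1 this
  have hnonneg {x : ℝ} (hx : 0 ≤ x) : p x = 0 := by
    have hcl : IsClosed {x | p x = 0} := isClosed_eq hpc continuous_const
    have hsub : Set.Ioi 0 ⊆ {x | p x = 0} := fun y hy => hpos hy
    exact hcl.closure_subset_iff.2 hsub (by rw [closure_Ioi]; exact hx)
  have hall : p ξ = 0 := by
    rcases le_total 0 ξ with hξ | hξ
    · exact hnonneg hξ
    · rw [← hpe]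
      exact hnonneg (neg_nonneg.2 hξ)
  exact sub_eq_zero.1 hall

end WaveletInvariants

theorem mainTheorem1 (ψ : ℝ → ℂ) (hψ : WaveletInvariants.IsWavelet ψ)
    (hcond : WaveletInvariants.LinearIndependenceCondition ψ)
    (hsupp : HasCompactSupport (WaveletInvariants.angularFourier ψ))
    (f g : ℝ → ℝ)
    (hf₁ : MemLp f 1 volume) (hf₂ : MemLp f 2 volume)
    (hg₁ : MemLp g 1 volume) (hg₂ : MemLp g 2 volume) :
    WaveletInvariants.waveletInvariant ψ f = WaveletInvariants.waveletInvariant ψ g ↔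
      WaveletInvariants.powerSpectrum f = WaveletInvariants.powerSpectrum g := by
  have hψ₁ : Integrable ψ := memLp_one_iff_integrable.1 hψ.memLp_one
  have hf := memLp_one_iff_integrable.1 hf₁
  have hg := memLp_one_iff_integrable.1 hg₁
  rw [WaveletInvariants.powerSpectrum_eq_iff]
  refine ⟨fun h => ?_, fun h => funext fun l => ?_⟩
  · have hs : HasCompactSupport (𝓕 ψ) := by
      have h2 : (2 * Real.pi) ≠ 0 := by positivity
      have := hsupp.comp_homeomorph (Homeomorph.mulLeft₀ (2 * Real.pi) h2)
      convert this using 1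
      exact funext fun ξ => WaveletInvariants.fourier_eq_angularFourier ψ ξ
    exact WaveletInvariants.norm_fourier_sq_eq_of_waveletInvariant_eq hψ₁ hcond hs hf hf₂ hg hg₂ h
  · simp only [WaveletInvariants.waveletInvariant_eq_lintegral hψ₁ hf,
      WaveletInvariants.waveletInvariant_eq_lintegral hψ₁ hg, h]
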